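/- Let $M$ be a compact connected topological manifold of dimension $n+1\ge 1$, possibly with boundary, equipped with a path metric (a metric inducing the topology of $M$ in which the distance of two points is the infimum of the lengths of paths joining them, e.g. a Riemannian distance). A slithering of $M$ around $S^1=\mathbb R/\mathbb Z$ is a connected regular covering $p:M'\to M$ together with a locally trivial fibration $s:M'\to S^1$, whose fibers are $n$-manifolds (possibly with boundary), such that every deck transformation of $p$ takes fibers of $s$ to fibers of $s$. The images under $p$ of the components of the fibers of $s$ are the leaves of a codimension-one foliation $\mathcal F(s)$ of $M$. Let $q:X\to M$ be the universal cover, let $d$ be the lifted path metric on $X$ (the infimum of the lengths in $M$ of the projections of paths in $X$), and let $\widetilde{\mathcal F}(s)$ be the lifted foliation. Then for every slithering $s$ of $M$ around $S^1$: (1) $\mathcal F(s)$ is uniform. That is, no closed curve in $M$ transverse to $\mathcal F(s)$ is null-homotopic, and for any two leaves $L,L'$ of $\widetilde{\mathcal F}(s)$, each of $L,L'$ is contained in a bounded neighborhood of the other. (A closed curve is transverse if its transverse coordinate in foliated charts is locally injective.) (2) There is a continuous map $\tilde s:X\to\mathbb R$ which lifts $s$, i.e. $\tilde s(x) \bmod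 \mathbb Z = s(f(x))$ for some continuous $f:X\to M'$ with $p\circ f=q$; and there are constants $C,c>0$, depending only on $M$, its metric and the slithering, such that for every such lift $\tilde s$ the leaves of $\widetilde{\mathcal F}(s)$ are exactly the fibers $L_r=\tilde s^{-1}(r)$, $r\in\mathbb R$, and for all $r,t\in\mathbb R$ $$d(x,L_t)\le C\,|z(L_r,L_t)|\quad\text{for all }x\in L_r,\qquad d(x,y)\ge c\,\bigl(|z(L_r,L_t)|-1\bigr)\quad\text{for all }x\in L_r,\ y\in L_t,$$ where $z(L_r,L_t)=2(t-r)$ if $t-r\in\mathbb Z$ and $z(L_r,L_t)=2\lfloor t-r\rfloor+1$ otherwise. (The first bound holds in the form: some $y\in L_t$ has $d(x,y)\le C|z(L_r,L_t)|$.) -/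

import Mathlib

open Set Topology
open scoped ENNReal

/-- The closed half-space `{x ∈ ℝᵏ | 0 ≤ x₀}` (a point when `k = 0`), the local model of
topological `k`-manifolds with (possibly empty) boundary. -/
abbrev HalfSpace (k : ℕ) : Type :=
  {x : EuclideanSpace ℝ (Fin k) // ∀ i : Fin k, (i : ℕ) = 0 → 0 ≤ x i}

/-! ### Codimension-one foliations -/

/-- A (topological) codimension-one foliation with `k`-dimensional leaves on a space `M`, given by
an atlas of foliated charts with values in `HalfSpace k × ℝ`.  The leaves are horizontal in each
chart (hence transverse to the boundary of `M`), and coordinate changes locally preserve the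
partition into horizontal slices `{second coordinate = constant}`. -/
structure Foliation (k : ℕ) (M : Type*) [TopologicalSpace M] where
  charts : Set (OpenPartialHomeomorph M (HalfSpace k × ℝ))
  exists_chart : ∀ x, ∃ e ∈ charts, x ∈ e.source
  compatible : ∀ e ∈ charts, ∀ e' ∈ charts, ∀ x ∈ e.source ∩ e'.source,
    ∃ U ∈ 𝓝 x, ∀ y ∈ U, ∀ z ∈ U, (e y).2 = (e z).2 ↔ (e' y).2 = (e' z).2

namespace Foliation

variable {k : ℕ} {M X : Type*} [TopologicalSpace M] [TopologicalSpace X]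

/-- A path is leafwise if its transverse coordinate in foliated charts is locally constant. -/
def IsLeafwise (F : Foliation k M) (γ : unitInterval → M) : Prop :=
  ∀ t, ∀ e ∈ F.charts, γ t ∈ e.source → ∀ᶠ t' in 𝓝 t, (e (γ t')).2 = (e (γ t)).2

/-- The leaf through `x`: all points which can be joined to `x` by a leafwise path. -/
def leaf (F : Foliation k M) (x : M) : Set M :=
  {y | ∃ γ : Path x y, F.IsLeafwise γ}

/-- The set of all leaves. -/
def leaves (F : Foliation k M) : Set (Set M) :=
  Set.range F.leaf

/-- A closed curve is transverse to the foliation if its transverse coordinate in foliated charts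
is locally injective (equivalently, locally strictly monotone). -/
def IsTransverse (F : Foliation k M) (γ : C(UnitAddCircle, M)) : Prop :=
  ∀ t, ∀ e ∈ F.charts, γ t ∈ e.source → ∃ U ∈ 𝓝 t, InjOn (fun t' => (e (γ t')).2) U

/-- The foliation induced on `X` by a local homeomorphism `q : X → M` (for instance a covering
map): its charts are the local restrictions of `q` followed by charts of `F`. -/
def lift (F : Foliation k M) {q : X → M} (hq : IsLocalHomeomorph q) : Foliation k X where
  charts := {e' | ∃ φ : OpenPartialHomeomorph X M, ∃ e ∈ F.charts, ⇑φ = q ∧ e' = φ.trans e}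
  exists_chart x := by
    obtain ⟨φ, hx, hφ⟩ := hq x
    obtain ⟨e, he, hxe⟩ := F.exists_chart (q x)
    refine ⟨φ.trans e, ⟨φ, e, he, hφ.symm, rfl⟩, ?_⟩
    rw [OpenPartialHomeomorph.trans_source]
    exact ⟨hx, by rw [mem_preimage, ← hφ]; exact hxe⟩
  compatible := by
    rintro _ ⟨φ, e, he, hφ, rfl⟩ _ ⟨φ', e', he', hφ', rfl⟩ x ⟨hx, hx'⟩
    rw [OpenPartialHomeomorph.trans_source] at hx hx'
    have h1 : q x ∈ e.source := by have := hx.2; rwa [mem_preimage, hφ] at this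
    have h2 : q x ∈ e'.source := by have := hx'.2; rwa [mem_preimage, hφ'] at this
    obtain ⟨U, hU, h⟩ := F.compatible e he e' he' (q x) ⟨h1, h2⟩
    refine ⟨q ⁻¹' U, hq.continuous.continuousAt hU, fun y hy z hz => ?_⟩
    simpa [hφ, hφ'] using h (q y) hy (q z) hz

end Foliation

/-! ### Path metrics and their lifts to covering spaces -/

/-- The metric of `M` is a path metric (length metric): the distance between two points is the
infimum of the lengths of the paths joining them.  A Riemannian distance is an example. -/
def IsPathMetric (M : Type*) [MetricSpace M] : Prop :=
  ∀ x y : M, edist x y = ⨅ γ : Path x y, eVariationOn (γ : unitInterval → M) univ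

/-- The path metric on `X` lifted from `M` along `q : X → M`: the infimum of the lengths, measured
in `M`, of the paths in `X` joining two given points. -/
noncomputable def liftedEDist {M X : Type*} [MetricSpace M] [TopologicalSpace X] (q : X → M)
    (x y : X) : ℝ≥0∞ :=
  ⨅ γ : Path x y, eVariationOn (q ∘ (γ : unitInterval → X)) univ

/-- A foliation `F` of `M`, with universal covering `q : X → M`, is uniform if no closed transverse
curve is null-homotopic and if, for any two leaves of the lifted foliation of `X`, each is
contained in a bounded neighbourhood of the other. -/
def Foliation.IsUniform {k : ℕ} {M X : Type*} [MetricSpace M] [TopologicalSpace X]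
    [SimplyConnectedSpace X] (F : Foliation k M) {q : X → M} (hq : IsCoveringMap q) : Prop :=
  (∀ γ : C(UnitAddCircle, M), F.IsTransverse γ → ¬ γ.Nullhomotopic) ∧
  ∀ L₁ ∈ (F.lift hq.isLocalHomeomorph).leaves, ∀ L₂ ∈ (F.lift hq.isLocalHomeomorph).leaves,
    ∃ C : ℝ, (∀ x ∈ L₁, ∃ y ∈ L₂, liftedEDist q x y ≤ ENNReal.ofReal C) ∧
      (∀ y ∈ L₂, ∃ x ∈ L₁, liftedEDist q y x ≤ ENNReal.ofReal C)

/-! ### Slitherings -/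

/-- A slithering of `M` around `N` with `k`-dimensional fibers: a regular covering
`p : M' → M` with connected total space, together with a fibration `s : M' → N` (a locally trivial
bundle whose fibers are `k`-manifolds, possibly with boundary) such that every deck transformation
of `p` takes fibers of `s` to fibers of `s`. -/
structure Slithering (k : ℕ) (M M' N : Type*) [TopologicalSpace M] [TopologicalSpace M']
    [TopologicalSpace N] where
  p : M' → M
  connected : ConnectedSpace M'
  isCoveringMap : IsCoveringMap p
  surjective : Function.Surjective p
  regular : ∀ x y, p x = p y → ∃ φ : M' ≃ₜ M', p ∘ φ = p ∧ φ x = y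
  s : M' → N
  locallyTrivial : ∀ b, ∃ e : Bundle.Trivialization (s ⁻¹' {b}) s, b ∈ e.baseSet
  fiber_manifold : ∀ b, Nonempty (ChartedSpace (HalfSpace k) (s ⁻¹' {b}))
  deck_fiber : ∀ φ : M' ≃ₜ M', p ∘ φ = p → ∀ x y, s x = s y → s (φ x) = s (φ y)

namespace Slithering

variable {k : ℕ} {M M' : Type*} [TopologicalSpace M] [TopologicalSpace M']

/-- A deck transformation and its inverse preserve fibers, so fibers go onto fibers. -/
theorem deck_fiber_iff {N : Type*} [TopologicalSpace N] (S : Slithering k M M' N)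
    (φ : M' ≃ₜ M') (hφ : S.p ∘ φ = S.p) (x y : M') :
    S.s (φ x) = S.s (φ y) ↔ S.s x = S.s y := by
  refine ⟨fun h => ?_, S.deck_fiber φ hφ x y⟩
  have h' : S.p ∘ φ.symm = S.p := by
    funext z
    simpa using (congrFun hφ (φ.symm z)).symm
  simpa using S.deck_fiber φ.symm h' _ _ h

/-- Near every point of `M'` there is a chart with values in `HalfSpace k × ℝ` whose horizontal
slices are locally the fibers of `s`. -/
theorem exists_local_chart (S : Slithering k M M' UnitAddCircle) (x : M') :
    ∃ e : OpenPartialHomeomorph M' (HalfSpace k × ℝ), x ∈ e.source ∧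
      ∀ y ∈ e.source, ∀ z ∈ e.source, (e y).2 = (e z).2 ↔ S.s y = S.s z := by
  obtain ⟨T, hT⟩ := S.locallyTrivial (S.s x)
  obtain ⟨cs⟩ := S.fiber_manifold (S.s x)
  obtain ⟨r, hr⟩ := QuotientAddGroup.mk_surjective (S.s x)
  obtain ⟨ψ, hψr, hψ⟩ := AddCircle.isLocalHomeomorph_coe (1 : ℝ) r
  have hxT : x ∈ T.source := T.mem_source.2 hT
  have hψ' : ψ r = S.s x := by rw [← hψ]; exact hr
  let c := cs.chartAt (T x).2
  let e₁ : OpenPartialHomeomorph M' (HalfSpace k × ℝ) :=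
    T.toOpenPartialHomeomorph.trans
      ((ψ.symm.prod c).trans (Homeomorph.prodComm ℝ (HalfSpace k)).toOpenPartialHomeomorph)
  have hsrc : ∀ y ∈ e₁.source, y ∈ T.source ∧ S.s y ∈ ψ.target := by
    intro y hy
    simp only [e₁, OpenPartialHomeomorph.trans_source] at hy
    refine ⟨hy.1, ?_⟩
    have h2 := hy.2.1.1
    rw [← T.coe_fst hy.1]
    exact h2
  have hval : ∀ y ∈ e₁.source, (e₁ y).2 = ψ.symm (S.s y) := by
    intro y hy
    rw [← T.coe_fst (hsrc y hy).1]
    rfl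
  refine ⟨e₁, ?_, fun y hy z hz => ?_⟩
  · have h3 : (T x).1 ∈ ψ.target := by
      rw [T.coe_fst hxT, ← hψ']; exact ψ.map_source hψr
    have h4 : (T x).2 ∈ c.source := cs.mem_chart_source _
    simp only [e₁, OpenPartialHomeomorph.trans_source]
    exact ⟨hxT, ⟨h3, h4⟩, mem_univ _⟩
  · rw [hval y hy, hval z hz]
    exact ψ.symm.injOn.eq_iff (hsrc y hy).2 (hsrc z hz).2

/-- The codimension-one foliation `F(s)` of `M` defined by a slithering around the circle
`ℝ / ℤ`: its charts are all charts of `M` in which the horizontal slices are locally the images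
under `p` of the fibers of `s`.  Its leaves are the images under `p` of the components of the
fibers of `s`. -/
def foliation (S : Slithering k M M' UnitAddCircle) : Foliation k M where
  charts := {e | ∀ x, S.p x ∈ e.source →
    ∃ U ∈ 𝓝 x, ∀ y ∈ U, ∀ z ∈ U, (e (S.p y)).2 = (e (S.p z)).2 ↔ S.s y = S.s z}
  exists_chart m := by
    obtain ⟨x, rfl⟩ := S.surjective m
    obtain ⟨e, hxe, he⟩ := S.exists_local_chart x
    obtain ⟨φ, hxφ, hφ⟩ := S.isCoveringMap.isLocalHomeomorph x
    refine ⟨φ.symm.trans e, ?_, ?_⟩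
    · intro y hy
      rw [OpenPartialHomeomorph.trans_source] at hy
      obtain ⟨hy1, hy2⟩ := hy
      set w := φ.symm (S.p y) with hw
      have hwy : S.p w = S.p y := (congrFun hφ w).trans (φ.right_inv hy1)
      obtain ⟨g, hg, hgy⟩ := S.regular y w hwy.symm
      have hwφ : w ∈ φ.source := φ.map_target hy1
      refine ⟨g ⁻¹' (φ.source ∩ e.source), g.continuous.continuousAt ?_, ?_⟩
      · rw [hgy]
        exact (φ.open_source.inter e.open_source).mem_nhds ⟨hwφ, hy2⟩
      · intro a ha b hb
        have key : ∀ a, g a ∈ φ.source → φ.symm (S.p a) = g a := by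
          intro a ha
          have : S.p a = φ (g a) := by rw [← hφ]; exact (congrFun hg a).symm
          rw [this]; exact φ.left_inv ha
        simp only [OpenPartialHomeomorph.coe_trans, Function.comp_apply]
        rw [key a ha.1, key b hb.1, he _ ha.2 _ hb.2, S.deck_fiber_iff g hg]
    · rw [OpenPartialHomeomorph.trans_source]
      have h1 : φ x = S.p x := by rw [hφ]
      refine ⟨?_, ?_⟩
      · rw [← h1]; exact φ.map_source hxφ
      · rw [mem_preimage, ← h1, φ.left_inv hxφ]; exact hxe
  compatible := by
    rintro e he e' he' m ⟨hm, hm'⟩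
    obtain ⟨x, rfl⟩ := S.surjective m
    obtain ⟨U, hU, h⟩ := he x hm
    obtain ⟨U', hU', h'⟩ := he' x hm'
    refine ⟨S.p '' (U ∩ U'),
      S.isCoveringMap.isLocalHomeomorph.isOpenMap.image_mem_nhds (Filter.inter_mem hU hU'), ?_⟩
    rintro _ ⟨y, hy, rfl⟩ _ ⟨z, hz, rfl⟩
    rw [h y hy.1 z hz.1, h' y hy.2 z hz.2]

/-- `ℓ : X → ℝ` is a lift of the slithering to the covering space `q : X → M`: it lifts, through
`ℝ → ℝ / ℤ`, the map `s ∘ f : X → ℝ / ℤ` for some continuous `f : X → M'` with `p ∘ f = q`. -/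
def IsRealLift {X : Type*} [TopologicalSpace X] (S : Slithering k M M' UnitAddCircle) (q : X → M)
    (ℓ : X → ℝ) : Prop :=
  Continuous ℓ ∧ ∃ f : X → M', Continuous f ∧ S.p ∘ f = q ∧
    ∀ x, (ℓ x : UnitAddCircle) = S.s (f x)

end Slithering

/-- The combinatorial separation `z(L_r, L_t)` of the leaves at heights `r` and `t`:
`2 (t - r)` if `t - r` is an integer, and `2 ⌊t - r⌋ + 1` otherwise. -/
noncomputable def zSep (r t : ℝ) : ℤ :=
  open Classical in if (⌊t - r⌋ : ℝ) = t - r then 2 * ⌊t - r⌋ else 2 * ⌊t - r⌋ + 1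

/-! ### Lifting through coverings -/

/-! Everything is read off a real lift `ℓ : X → ℝ`, which exists because `X` is simply connected.
Local trivializations of `s`, lifted to `X` by homotopy lifting, move points continuously between
nearby fibers of `ℓ` (`IsRealLift.hasLocalTransport`). Hence `ℓ` is open and onto, and a path with
endpoints in one fiber can be squeezed into that fiber (`exists_path_in_fiber`), so the leaves
upstairs are exactly the fibers of `ℓ`. A null-homotopic closed transversal would lift to a closed
curve along which `ℓ` is locally injective, which fails at a maximum.

For the metric bounds, a deck transformation `g` of `q` turns `ℓ` into another real lift `ℓ ∘ g`.
Two real lifts differ by a monotone injection of the line that preserves and reflects congruence mod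
`ℤ` (`exists_reparametrization`). Such a map distorts lengths, but it respects the unit scale:
variation less than one stays less than one. Estimates at unit scale are therefore invariant under
deck transformations, and compactness of `M` makes them uniform: a change of one unit costs length
at least `δ` (`exists_uniform_sheets`), and every height within one unit is reached within distance
`C` (`exists_unit_upper_bound`). Adding up unit steps gives both inequalities. -/

instance HalfSpace.locallyPathConnectedSpace (k : ℕ) : LocallyPathConnectedSpace (HalfSpace k) := by
  have h : Convex ℝ {x : EuclideanSpace ℝ (Fin k) | ∀ i : Fin k, (i : ℕ) = 0 → 0 ≤ x i} := by
    intro x hx y hy a b ha hb _ i hi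
    have h1 := hx i hi
    have h2 := hy i hi
    simp only [PiLp.add_apply, PiLp.smul_apply, smul_eq_mul]
    positivity
  exact h.locallyPathConnectedSpace

theorem IsLocalHomeomorph.locallyPathConnectedSpace {X M : Type*} [TopologicalSpace X]
    [TopologicalSpace M] [LocallyPathConnectedSpace M] {q : X → M} (hq : IsLocalHomeomorph q) :
    LocallyPathConnectedSpace X := by
  choose φ hφ _ using hq
  let _ : ChartedSpace M X :=
    { atlas := univ
      chartAt := φ
      mem_chart_source := hφ
      chart_mem_atlas := fun _ => mem_univ _ }
  exact ChartedSpace.locallyPathConnectedSpace M X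

/-- A covering map may have empty fibers. Over an evenly covered neighborhood of `m` the preimage is
a product with the fiber over `m`, so a point of the range in it makes that fiber nonempty. -/
theorem IsCoveringMap.isClosed_range {X M : Type*} [TopologicalSpace X] [TopologicalSpace M]
    {q : X → M} (hq : IsCoveringMap q) : IsClosed (range q) := by
  rw [← isOpen_compl_iff, isOpen_iff_mem_nhds]
  intro m hm
  obtain ⟨-, U, hmU, hU, -, H, -⟩ := hq m
  refine Filter.mem_of_superset (hU.mem_nhds hmU) ?_
  rintro _ hy ⟨x, rfl⟩
  exact hm ⟨_, (H ⟨x, hy⟩).2.2⟩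

theorem IsCoveringMap.surjective_of_connected {X M : Type*} [TopologicalSpace X]
    [TopologicalSpace M] [Nonempty X] [ConnectedSpace M] {q : X → M} (hq : IsCoveringMap q) :
    Function.Surjective q :=
  range_eq_univ.1 <|
    IsClopen.eq_univ ⟨hq.isClosed_range, hq.isOpenMap.isOpen_range⟩ (range_nonempty q)

/-- Simply connected coverings are regular. -/
theorem IsCoveringMap.exists_deck {X M : Type*} [TopologicalSpace X] [TopologicalSpace M]
    [SimplyConnectedSpace X] [LocallyPathConnectedSpace X] {q : X → M} (hq : IsCoveringMap q)
    {x y : X} (h : q x = q y) : ∃ g : X ≃ₜ X, q ∘ g = q ∧ g x = y := by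
  obtain ⟨a, ⟨ha, ha'⟩, -⟩ := hq.existsUnique_continuousMap_lifts ⟨q, hq.continuous⟩ x y h.symm
  obtain ⟨b, ⟨hb, hb'⟩, -⟩ := hq.existsUnique_continuousMap_lifts ⟨q, hq.continuous⟩ y x h
  simp only [ContinuousMap.coe_mk] at ha' hb'
  have hba : b ∘ a = id := hq.eq_of_comp_eq (b.continuous.comp a.continuous) continuous_id
    (by rw [← Function.comp_assoc, hb', ha', Function.comp_id]) x (by simp [ha, hb])
  have hab : a ∘ b = id := hq.eq_of_comp_eq (a.continuous.comp b.continuous) continuous_id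
    (by rw [← Function.comp_assoc, ha', hb', Function.comp_id]) y (by simp [ha, hb])
  exact ⟨⟨⟨a, b, congrFun hba, congrFun hab⟩, a.continuous, b.continuous⟩, ha', ha⟩

theorem unitAddCircle_isCoveringMap_coe : IsCoveringMap ((↑) : ℝ → UnitAddCircle) :=
  AddCircle.isCoveringMap_coe 1

theorem unitAddCircle_coe_eq_iff {a b : ℝ} :
    (a : UnitAddCircle) = b ↔ ∃ k : ℤ, b - a = k := by
  rw [eq_comm, QuotientAddGroup.eq_iff_sub_mem, AddSubgroup.mem_zmultiples_iff]
  simp [eq_comm]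

/-! ### Real lifts and deck transformations. -/

namespace Slithering

variable {k : ℕ} {M M' : Type*} [TopologicalSpace M] [TopologicalSpace M']

theorem continuous_s {N : Type*} [TopologicalSpace N] (S : Slithering k M M' N) :
    Continuous S.s := by
  rw [continuous_iff_continuousAt]
  intro x
  obtain ⟨T, hT⟩ := S.locallyTrivial (S.s x)
  exact T.continuousAt_proj (T.mem_source.2 hT)

variable {X : Type*} [TopologicalSpace X]

/-- Two liftings in succession: `q` through `p`, then `s ∘ f` through `ℝ → ℝ / ℤ`. -/
theorem exists_isRealLift [SimplyConnectedSpace X] [LocallyPathConnectedSpace X]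
    (S : Slithering k M M' UnitAddCircle) {q : X → M} (hq : Continuous q) :
    ∃ ℓ, S.IsRealLift q ℓ := by
  obtain ⟨x⟩ : Nonempty X := inferInstance
  obtain ⟨m, hm⟩ := S.surjective (q x)
  obtain ⟨f, ⟨-, hf⟩, -⟩ := S.isCoveringMap.existsUnique_continuousMap_lifts ⟨q, hq⟩ x m hm
  obtain ⟨r, hr⟩ := QuotientAddGroup.mk_surjective (S.s (f x))
  obtain ⟨ℓ, ⟨-, hℓ⟩, -⟩ := unitAddCircle_isCoveringMap_coe.existsUnique_continuousMap_lifts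
    ⟨S.s ∘ f, S.continuous_s.comp f.continuous⟩ x r hr
  exact ⟨ℓ, ℓ.continuous, f, f.continuous, hf, congrFun hℓ⟩

/-- This is why later estimates are stated for all real lifts at once: they can then be carried
along by deck transformations. -/
theorem IsRealLift.comp_deck {S : Slithering k M M' UnitAddCircle} {q : X → M} {ℓ : X → ℝ}
    (h : S.IsRealLift q ℓ) (g : X ≃ₜ X) (hg : q ∘ g = q) : S.IsRealLift q (ℓ ∘ g) := by
  obtain ⟨hc, f, hf, hpf, hs⟩ := h
  refine ⟨hc.comp g.continuous, f ∘ g, hf.comp g.continuous, ?_, fun x => hs (g x)⟩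
  rw [← Function.comp_assoc, hpf, hg]

/-- Two real lifts have the same fibers, up to integral translation of the values. -/
theorem IsRealLift.coe_eq_iff [PreconnectedSpace X] {S : Slithering k M M' UnitAddCircle}
    {q : X → M} {ℓ ℓ' : X → ℝ} (h : S.IsRealLift q ℓ) (h' : S.IsRealLift q ℓ') (x y : X) :
    (ℓ' x : UnitAddCircle) = ℓ' y ↔ (ℓ x : UnitAddCircle) = ℓ y := by
  obtain ⟨-, f, hf, hpf, hs⟩ := h
  obtain ⟨-, f', hf', hpf', hs'⟩ := h'
  -- `f` and `f'` both lift `q` through `p`, so a deck transformation matching them at one point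
  -- matches them everywhere, and it respects the fibers of `s`.
  obtain ⟨φ, hφ, hφx⟩ := S.regular (f x) (f' x) ((congrFun hpf x).trans (congrFun hpf' x).symm)
  have key : φ ∘ f = f' := S.isCoveringMap.eq_of_comp_eq (φ.continuous.comp hf) hf'
    (by rw [← Function.comp_assoc, hφ, hpf, hpf']) x hφx
  rw [hs, hs, hs', hs', ← key]
  exact S.deck_fiber_iff φ hφ _ _

end Slithering

/-! ### Local transport between the fibers of a real function -/

/-- `ℓ : X → ℝ` admits local transport if, over a ball around any `r : ℝ`, points can be moved
continuously between the fibers of `ℓ`. -/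
def HasLocalTransport {X : Type*} [TopologicalSpace X] (ℓ : X → ℝ) : Prop :=
  ∀ r : ℝ, ∃ ε > 0, ∃ τ : X → ℝ → X,
    ContinuousOn (Function.uncurry τ) ((ℓ ⁻¹' Metric.ball r ε) ×ˢ Metric.ball r ε) ∧
    ∀ x t, ℓ x ∈ Metric.ball r ε → t ∈ Metric.ball r ε → ℓ (τ x t) = t ∧ τ x (ℓ x) = x

namespace HasLocalTransport

variable {X : Type*} [TopologicalSpace X] {ℓ : X → ℝ}

/-- Exchanges sublevel and superlevel sets, so that one retraction lemma serves both. -/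
theorem neg (h : HasLocalTransport ℓ) : HasLocalTransport (fun x => -ℓ x) := by
  intro r
  obtain ⟨ε, hε, τ, hτ, H⟩ := h (-r)
  have hb : ∀ t : ℝ, t ∈ Metric.ball r ε ↔ -t ∈ Metric.ball (-r) ε := by
    intro t
    rw [Metric.mem_ball, Metric.mem_ball, dist_neg_neg]
  refine ⟨ε, hε, fun x t => τ x (-t), ?_, fun x t hx ht => ?_⟩
  · refine hτ.comp (f := fun z : X × ℝ => (z.1, -z.2)) (by fun_prop) ?_
    rintro ⟨x, t⟩ ⟨hx, ht⟩
    refine ⟨?_, (hb t).1 ht⟩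
    simpa using (hb _).1 hx
  · have hx' : ℓ x ∈ Metric.ball (-r) ε := by simpa using (hb _).1 hx
    obtain ⟨h1, h2⟩ := H x (-t) hx' ((hb t).1 ht)
    exact ⟨by simp [h1], by simp [h2]⟩

/-- Near `ℓ x`, the map `t ↦ τ x t` is a continuous local section of `ℓ` through `x`. -/
theorem isOpenMap (h : HasLocalTransport ℓ) : IsOpenMap ℓ := by
  rw [isOpenMap_iff_nhds_le]
  intro x
  obtain ⟨ε, hε, τ, hτ, H⟩ := h (ℓ x)
  have hx : ℓ x ∈ Metric.ball (ℓ x) ε := Metric.mem_ball_self hε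
  have hball : Metric.ball (ℓ x) ε ∈ 𝓝 (ℓ x) := Metric.ball_mem_nhds _ hε
  have hcont : ContinuousOn (τ x) (Metric.ball (ℓ x) ε) :=
    hτ.comp (f := fun t => (x, t)) (by fun_prop) fun t ht => ⟨hx, ht⟩
  have ht : Filter.Tendsto (τ x) (𝓝 (ℓ x)) (𝓝 x) := by
    have := (hcont.continuousAt hball).tendsto
    rwa [(H x _ hx hx).2] at this
  calc 𝓝 (ℓ x) = Filter.map (ℓ ∘ τ x) (𝓝 (ℓ x)) := by
        conv_lhs => rw [← Filter.map_id (f := 𝓝 (ℓ x))]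
        refine Filter.map_congr ?_
        filter_upwards [hball] with t ht
        exact (H x t hx ht).1.symm
    _ ≤ Filter.map ℓ (𝓝 x) := by
        rw [← Filter.map_map]
        exact Filter.map_mono ht

/-- The range is open, and closed as well: if a transport ball around `r` meets it, transporting to
height `r` shows that `r` belongs to it. -/
theorem surjective [Nonempty X] (h : HasLocalTransport ℓ) : Function.Surjective ℓ := by
  refine range_eq_univ.1 (IsClopen.eq_univ ⟨?_, h.isOpenMap.isOpen_range⟩ (range_nonempty ℓ))
  rw [← closure_subset_iff_isClosed]
  intro r hr
  obtain ⟨ε, hε, τ, -, H⟩ := h r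
  obtain ⟨_, hb, x, rfl⟩ := mem_closure_iff_nhds.1 hr _ (Metric.ball_mem_nhds r hε)
  exact ⟨τ x r, (H x r hb (Metric.mem_ball_self hε)).1⟩

/-- The sublevel set at height `b` retracts onto the sublevel set at height `a ≤ b`. -/
theorem exists_retraction (h : HasLocalTransport ℓ) (hℓ : Continuous ℓ) {a b : ℝ} (hab : a ≤ b) :
    ∃ ρ : X → X, ContinuousOn ρ (ℓ ⁻¹' Iic b) ∧
      ∀ x, ℓ x ≤ b → ℓ (ρ x) = min (ℓ x) a ∧ (ℓ x ≤ a → ρ x = x) := by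
  choose ε hε τ hτ H using h
  -- Cut `[a, b]` into finitely many intervals, each inside one transport ball, and compose the
  -- retractions of the slabs.
  obtain ⟨t, h0, hmono, ⟨m, hm⟩, hsub⟩ := exists_monotone_Icc_subset_open_cover_Icc hab
    (c := fun r : ℝ => (Subtype.val ⁻¹' Metric.ball r (ε r) : Set (Icc a b)))
    (fun r => Metric.isOpen_ball.preimage continuous_subtype_val)
    (fun z _ => mem_iUnion.2 ⟨z.1, Metric.mem_ball_self (hε z.1)⟩)
  suffices hn : ∀ n, ∃ ρ : X → X, ContinuousOn ρ (ℓ ⁻¹' Iic (t n : ℝ)) ∧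
      ∀ x, ℓ x ≤ t n → ℓ (ρ x) = min (ℓ x) a ∧ (ℓ x ≤ a → ρ x = x) by
    have := hn m
    rwa [hm m le_rfl] at this
  intro n
  induction n with
  | zero =>
    refine ⟨id, continuousOn_id, fun x hx => ⟨?_, fun _ => rfl⟩⟩
    rw [h0] at hx
    exact (min_eq_left hx).symm
  | succ n ih =>
    obtain ⟨ρ, hρ, hρ'⟩ := ih
    obtain ⟨r, hr⟩ := hsub n
    have hle : (t n : ℝ) ≤ t (n + 1) := hmono n.le_succ
    have hn : (t n : ℝ) ∈ Metric.ball r (ε r) := hr ⟨le_rfl, hmono n.le_succ⟩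
    have hmem : ∀ x, (t n : ℝ) ≤ ℓ x → ℓ x ≤ t (n + 1) → ℓ x ∈ Metric.ball r (ε r) := by
      intro x h1 h2
      exact hr (a := ⟨ℓ x, (t n).2.1.trans h1, h2.trans (t (n + 1)).2.2⟩) ⟨h1, h2⟩
    -- `σ` pushes the top slab down to level `t n`. The branches agree on that level because
    -- transport to a point's own height fixes it.
    let σ : X → X := fun x => if ℓ x ≤ t n then x else τ r x (t n)
    have hσ : ∀ x, ℓ x ≤ t (n + 1) → ℓ (σ x) = min (ℓ x) (t n) ∧ (ℓ x ≤ t n → σ x = x) := by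
      intro x hx
      by_cases hc : ℓ x ≤ t n
      · simp [σ, hc]
      · have := (H r x (t n) (hmem x (not_le.1 hc).le hx) hn).1
        simp [σ, hc, this, (not_le.1 hc).le]
    have hσc : ContinuousOn σ (ℓ ⁻¹' Iic (t (n + 1) : ℝ)) := by
      refine ContinuousOn.if ?_ continuousOn_id ?_
      · rintro x ⟨hx1, hx2⟩
        have heq : ℓ x = t n := frontier_le_subset_eq hℓ continuous_const hx2
        rw [← heq]
        exact (H r x (ℓ x) (heq ▸ hn) (heq ▸ hn)).2.symm
      · refine (hτ r).comp (f := fun x => (x, (t n : ℝ))) (by fun_prop) ?_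
        rintro x ⟨hx1, hx2⟩
        refine ⟨hmem x ?_ hx1, hn⟩
        have : x ∈ {y | (t n : ℝ) ≤ ℓ y} :=
          closure_lt_subset_le continuous_const hℓ (by simpa only [not_le] using hx2)
        exact this
    refine ⟨ρ ∘ σ, hρ.comp hσc fun x hx => ?_, fun x hx => ?_⟩
    · exact (hσ x hx).1.trans_le (min_le_right _ _)
    · obtain ⟨h1, h2⟩ := hσ x hx
      obtain ⟨h3, h4⟩ := hρ' (σ x) (by rw [h1]; exact min_le_right _ _)
      have han : a ≤ t n := (t n).2.1
      refine ⟨?_, fun hxa => ?_⟩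
      · rw [Function.comp_apply, h3, h1, min_assoc, min_eq_right han]
      · rw [Function.comp_apply, h4 (by rw [h2 (hxa.trans han)]; exact hxa), h2 (hxa.trans han)]

/-- The fibers of a function with local transport on a path connected space are path connected. -/
theorem exists_path_in_fiber [PathConnectedSpace X] (h : HasLocalTransport ℓ) (hℓ : Continuous ℓ)
    {x y : X} (hxy : ℓ x = ℓ y) : ∃ γ : Path x y, ∀ t, ℓ (γ t) = ℓ x := by
  obtain ⟨γ⟩ := PathConnectedSpace.joined x y
  obtain ⟨b, hb⟩ := (isCompact_range (hℓ.comp γ.continuous)).bddAbove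
  obtain ⟨c, hc⟩ := (isCompact_range (hℓ.comp γ.continuous)).bddBelow
  have hb' : ∀ t, ℓ (γ t) ≤ b := fun t => hb ⟨t, rfl⟩
  have hc' : ∀ t, c ≤ ℓ (γ t) := fun t => hc ⟨t, rfl⟩
  have hxb : ℓ x ≤ b := by simpa using hb' 0
  have hcx : c ≤ ℓ x := by simpa using hc' 0
  -- Squash an arbitrary path onto the fiber: `ρ` brings down what lies above level `ℓ x`, and `σ`
  -- raises what lies below it.
  obtain ⟨ρ, hρ, hρ'⟩ := h.exists_retraction hℓ hxb
  obtain ⟨σ, hσ, hσ'⟩ := h.neg.exists_retraction hℓ.neg (neg_le_neg hcx)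
  have h1 : ∀ t, -ℓ (ρ (γ t)) ≤ -c := by
    intro t
    rw [(hρ' _ (hb' t)).1]
    exact neg_le_neg (le_min (hc' t) hcx)
  have h2 : ∀ z, ℓ z = ℓ x → σ (ρ z) = z := by
    intro z hz
    have h3 : ρ z = z := (hρ' z (hz.le.trans hxb)).2 hz.le
    rw [h3]
    exact (hσ' z (neg_le_neg (hz ▸ hcx))).2 (by rw [hz])
  refine ⟨⟨⟨fun t => σ (ρ (γ t)), ?_⟩, ?_, ?_⟩, fun t => ?_⟩
  · exact hσ.comp_continuous (hρ.comp_continuous γ.continuous hb') h1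
  · simpa using h2 x rfl
  · simpa using h2 y hxy.symm
  · have h3 := (hσ' _ (h1 t)).1
    have h4 := (hρ' _ (hb' t)).1
    change ℓ (σ (ρ (γ t))) = ℓ x
    rw [h4, min_neg_neg, neg_inj] at h3
    rw [h3]
    exact max_eq_right (min_le_right _ _)

end HasLocalTransport

/-! ### Local transport for real lifts. -/

namespace Slithering

variable {k : ℕ} {M M' X : Type*} [TopologicalSpace M] [TopologicalSpace M'] [TopologicalSpace X]

/-- Local transport in a local trivialization of `s`, lifted to the covering `X`. -/
theorem IsRealLift.hasLocalTransport {S : Slithering k M M' UnitAddCircle} {q : X → M}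
    (hq : IsCoveringMap q) {ℓ : X → ℝ} (h : S.IsRealLift q ℓ) : HasLocalTransport ℓ := by
  obtain ⟨hℓ, f, hf, hpf, hs⟩ := h
  intro r
  obtain ⟨T, hT⟩ := S.locallyTrivial (r : UnitAddCircle)
  have hcoe : Continuous ((↑) : ℝ → UnitAddCircle) := AddCircle.continuous_mk' 1
  obtain ⟨ε, hε, hball⟩ := Metric.mem_nhds_iff.1
    ((T.open_baseSet.preimage hcoe).mem_nhds (x := r) hT)
  set J := Metric.ball r ε
  have hconv : ∀ (u : unitInterval) (a b : ℝ), a ∈ J → b ∈ J → (1 - (u : ℝ)) * a + u * b ∈ J :=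
    fun u a b ha hb => convex_ball r ε ha hb (sub_nonneg.2 u.2.2) u.2.1 (by ring)
  have hsrc : ∀ a : (ℓ ⁻¹' J) × J, f a.1 ∈ T.source := by
    intro a
    rw [T.mem_source, ← hs]
    exact hball a.1.2
  let v : unitInterval × (ℓ ⁻¹' J) × J → ℝ := fun z => (1 - (z.1 : ℝ)) * ℓ z.2.1 + z.1 * z.2.2
  have hv : Continuous v := by fun_prop
  have hvJ : ∀ z, v z ∈ J := fun z => hconv z.1 _ _ z.2.1.2 z.2.2.2
  -- In the trivialization, `P` keeps the fiber coordinate of `f x` and moves the base coordinate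
  -- along the segment from `ℓ x` to `t`. This takes place in `M'`, and its projection to `M` is
  -- then lifted to `X`.
  let P : unitInterval × (ℓ ⁻¹' J) × J → M' := fun z =>
    T.toOpenPartialHomeomorph.symm ((v z : UnitAddCircle), (T (f z.2.1)).2)
  have hP : Continuous P := by
    refine T.toOpenPartialHomeomorph.continuousOn_symm.comp_continuous ?_ fun z => ?_
    · refine (hcoe.comp hv).prodMk (continuous_snd.comp ?_)
      exact T.continuousOn_toFun.comp_continuous (hf.comp (by fun_prop)) fun z => hsrc z.2
    · exact T.mem_target.2 (hball (hvJ z))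
  have hsP : ∀ z, S.s (P z) = v z := fun z => T.proj_symm_apply' (hball (hvJ z))
  have hPf : ∀ z, v z = ℓ z.2.1 → P z = f z.2.1 := by
    intro z hz
    simp only [P, hz, hs]
    exact T.symm_apply_mk_proj (hsrc z.2)
  let H : C(unitInterval × (ℓ ⁻¹' J) × J, M) := ⟨S.p ∘ P, S.isCoveringMap.continuous.comp hP⟩
  let f₀ : C((ℓ ⁻¹' J) × J, X) := ⟨fun a => a.1, by fun_prop⟩
  have hH0 : ∀ a, H (0, a) = q (f₀ a) := by
    intro a
    change S.p (P (0, a)) = q a.1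
    rw [hPf (0, a) (by simp [v]), ← hpf, Function.comp_apply]
  let G := hq.liftHomotopy H f₀ hH0
  have hqG : ∀ z, q (G z) = S.p (P z) := congrFun (hq.liftHomotopy_lifts H f₀ hH0)
  have hG0 : ∀ a, G (0, a) = a.1 := hq.liftHomotopy_zero H f₀ hH0
  -- Uniqueness of lifts through `p` identifies `f ∘ G` with `P`. Uniqueness through `ℝ → ℝ / ℤ`
  -- then identifies `ℓ ∘ G` with `v`.
  have hfG : ∀ a u, f (G (u, a)) = P (u, a) := by
    intro a
    refine congrFun (S.isCoveringMap.eq_of_comp_eq (g₁ := fun u => f (G (u, a)))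
      (g₂ := fun u => P (u, a)) (by fun_prop) (by fun_prop) ?_ 0 ?_)
    · funext u
      exact (congrFun hpf _).trans (hqG _)
    · rw [hG0, hPf (0, a) (by simp [v])]
  have hℓG : ∀ a u, ℓ (G (u, a)) = v (u, a) := by
    intro a
    refine congrFun (unitAddCircle_isCoveringMap_coe.eq_of_comp_eq (g₁ := fun u => ℓ (G (u, a)))
      (g₂ := fun u => v (u, a)) (by fun_prop) (by fun_prop) ?_ 0 ?_)
    · funext u
      change (ℓ (G (u, a)) : UnitAddCircle) = v (u, a)
      rw [hs, hfG, hsP]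
    · simp [hG0, v]
  classical
  refine ⟨ε, hε, fun x t => if hx : ℓ x ∈ J ∧ t ∈ J then G (1, ⟨x, hx.1⟩, ⟨t, hx.2⟩) else x,
    ?_, fun x t hx ht => ⟨?_, ?_⟩⟩
  · rw [continuousOn_iff_continuous_domRestrict]
    refine (G.continuous.comp (f := fun z : ((ℓ ⁻¹' J) ×ˢ J : Set (X × ℝ)) =>
      ((1 : unitInterval), ((⟨z.1.1, z.2.1⟩, ⟨z.1.2, z.2.2⟩) : (ℓ ⁻¹' J) × J))) (by fun_prop)).congr ?_
    rintro ⟨⟨x, t⟩, hx, ht⟩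
    have : ℓ x ∈ J ∧ t ∈ J := ⟨hx, ht⟩
    simp [domRestrict, this]
  · have hxt : ℓ x ∈ J ∧ t ∈ J := ⟨hx, ht⟩
    simp only [hxt, and_self, dite_true, hℓG]
    simp [v]
  · have hxx : ℓ x ∈ J ∧ ℓ x ∈ J := ⟨hx, hx⟩
    simp only [hxx, and_self, dite_true]
    let a : (ℓ ⁻¹' J) × J := (⟨x, hx⟩, ⟨ℓ x, hx⟩)
    -- For `t = ℓ x` the segment is degenerate, so the homotopy in `M` is stationary and so is its
    -- lift.
    have := hq.const_of_comp (g := fun u => G (u, a)) (by fun_prop) (fun u u' => ?_) 1 0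
    · exact this.trans (hG0 a)
    · rw [hqG, hqG, hPf _ (by simp only [v, a]; ring), hPf _ (by simp only [v, a]; ring)]

/-! ### Comparison of two real lifts at unit scale. -/

section Comparison

variable [SimplyConnectedSpace X] {S : Slithering k M M' UnitAddCircle} {q : X → M} {ℓ ℓ' : X → ℝ}

/-- Along a path inside a fiber of `ℓ` the class of `ℓ'` mod `ℤ` is constant, hence so is `ℓ'`. -/
theorem IsRealLift.eq_of_eq (hq : IsCoveringMap q) (h : S.IsRealLift q ℓ)
    (h' : S.IsRealLift q ℓ') {x y : X} (hxy : ℓ x = ℓ y) : ℓ' x = ℓ' y := by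
  obtain ⟨γ, hγ⟩ := (h.hasLocalTransport hq).exists_path_in_fiber h.1 hxy
  have := unitAddCircle_isCoveringMap_coe.const_of_comp (g := ℓ' ∘ γ)
    (h'.1.comp γ.continuous) (fun t t' => ?_) 0 1
  · simpa using this
  · exact (h.coe_eq_iff h' _ _).2 (by rw [hγ, hγ])

/-- Two real lifts differ by a strictly monotone reparametrization of the line that maps
translates of `ℤ` to translates of `ℤ`. -/
theorem IsRealLift.exists_reparametrization (hq : IsCoveringMap q) (h : S.IsRealLift q ℓ)
    (h' : S.IsRealLift q ℓ') : ∃ θ : ℝ → ℝ, ℓ' = θ ∘ ℓ ∧ Continuous θ ∧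
      (StrictMono θ ∨ StrictAnti θ) ∧
      ∀ a b : ℝ, (θ a : UnitAddCircle) = θ b ↔ (a : UnitAddCircle) = b := by
  have hT := h.hasLocalTransport hq
  -- `σ` is only a set-theoretic section. Continuity of `ℓ' ∘ σ` comes from `ℓ` being a quotient
  -- map, injectivity from exchanging the two lifts.
  obtain ⟨σ, hσ⟩ := hT.surjective.hasRightInverse
  have hθ : ℓ' = (ℓ' ∘ σ) ∘ ℓ := by
    funext x
    exact h.eq_of_eq hq h' (hσ (ℓ x)).symm
  have hc : Continuous (ℓ' ∘ σ) := by
    rw [(hT.isOpenMap.isQuotientMap h.1 hT.surjective).continuous_iff, ← hθ]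
    exact h'.1
  refine ⟨ℓ' ∘ σ, hθ, hc, hc.strictMono_of_inj fun a b hab => ?_, fun a b => ?_⟩
  · rw [← hσ a, ← hσ b]
    exact h'.eq_of_eq hq h hab
  · rw [Function.comp_apply, Function.comp_apply, h.coe_eq_iff h', hσ a, hσ b]

theorem unitAddCircle_coe_eq_coe_of_add_one {a : ℝ} : ((a + 1 : ℝ) : UnitAddCircle) = a :=
  unitAddCircle_coe_eq_iff.2 ⟨-1, by push_cast; ring⟩

theorem one_le_abs_sub_of_coe_eq {a b : ℝ} (h : (a : UnitAddCircle) = b) (hne : a ≠ b) :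
    1 ≤ |b - a| := by
  obtain ⟨j, hj⟩ := unitAddCircle_coe_eq_iff.1 h
  rw [hj, ← Int.cast_abs, ← Int.cast_one, Int.cast_le]
  refine Int.one_le_abs ?_
  rintro rfl
  exact hne (by simpa [sub_eq_zero, eq_comm] using hj)

/-- If `ℓ` varies by less than one between two points, then so does any other real lift. -/
theorem IsRealLift.abs_sub_lt_one (hq : IsCoveringMap q) (h : S.IsRealLift q ℓ)
    (h' : S.IsRealLift q ℓ') {x y : X} (hxy : |ℓ y - ℓ x| < 1) : |ℓ' y - ℓ' x| < 1 := by
  obtain ⟨η, hη, hηc, -, hcoe⟩ := h.exists_reparametrization hq h'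
  by_contra! hcon
  have hx : ℓ' x = η (ℓ x) := congrFun hη x
  have hy : ℓ' y = η (ℓ y) := congrFun hη y
  -- A variation of at least one passes through `ℓ' x ± 1`, at some height `c` between `ℓ x` and `ℓ
  -- y`. Then `c` is congruent to `ℓ x` but different from it, so it lies at least one away.
  obtain ⟨w, hw, hw1⟩ : ∃ w ∈ uIcc (ℓ' x) (ℓ' y), w = ℓ' x + 1 ∨ w = ℓ' x - 1 := by
    rcases le_abs.1 hcon with h1 | h1
    · exact ⟨_, mem_uIcc.2 (Or.inl ⟨by linarith, by linarith⟩), Or.inl rfl⟩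
    · exact ⟨_, mem_uIcc.2 (Or.inr ⟨by linarith, by linarith⟩), Or.inr rfl⟩
  rw [hx, hy] at hw
  obtain ⟨c, hc, hcw⟩ := intermediate_value_uIcc hηc.continuousOn hw
  have h1 : (η c : UnitAddCircle) = η (ℓ x) := by
    rw [hcw, ← hx]
    rcases hw1 with rfl | rfl
    · exact unitAddCircle_coe_eq_coe_of_add_one
    · rw [← unitAddCircle_coe_eq_coe_of_add_one (a := ℓ' x - 1), sub_add_cancel]
  have hne : c ≠ ℓ x := by
    rintro rfl
    rw [← hx] at hcw
    rcases hw1 with h2 | h2 <;> linarith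
  have h2 := one_le_abs_sub_of_coe_eq ((hcoe _ _).1 h1).symm hne.symm
  have h3 := abs_sub_left_of_mem_uIcc hc
  linarith [abs_sub_comm (ℓ y) (ℓ x)]

/-- The values of `ℓ'` within distance one of `ℓ' x` are attained on the fibers of `ℓ` over
`[ℓ x - 1, ℓ x + 1]`. -/
theorem IsRealLift.exists_value (hq : IsCoveringMap q) (h : S.IsRealLift q ℓ)
    (h' : S.IsRealLift q ℓ') (x : X) {t : ℝ} (ht : |t - ℓ' x| ≤ 1) :
    ∃ a : ℝ, |a - ℓ x| ≤ 1 ∧ ∀ y, ℓ y = a → ℓ' y = t := by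
  obtain ⟨η, hη, hηc, hmono, hcoe⟩ := h.exists_reparametrization hq h'
  have hx : ℓ' x = η (ℓ x) := congrFun hη x
  rw [hx, abs_le] at ht
  suffices H : ∃ a ∈ Icc (ℓ x - 1) (ℓ x + 1), η a = t by
    obtain ⟨a, ha, hat⟩ := H
    refine ⟨a, abs_le.2 ⟨by linarith [ha.1], by linarith [ha.2]⟩, fun y hy => ?_⟩
    rw [hη, Function.comp_apply, hy, hat]
  have hp : ((ℓ x + 1 : ℝ) : UnitAddCircle) = ℓ x := unitAddCircle_coe_eq_coe_of_add_one
  have hm : ((ℓ x : ℝ) : UnitAddCircle) = ((ℓ x - 1 : ℝ) : UnitAddCircle) := by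
    rw [← unitAddCircle_coe_eq_coe_of_add_one (a := ℓ x - 1), sub_add_cancel]
  have hinj : Function.Injective η := hmono.elim StrictMono.injective StrictAnti.injective
  -- The values of `η` at `ℓ x ± 1` are congruent to `η (ℓ x)` and different from it, hence at least
  -- one away, on opposite sides by monotonicity.
  have h1 := one_le_abs_sub_of_coe_eq ((hcoe _ _).2 hp) (hinj.ne (by linarith))
  have h2 := one_le_abs_sub_of_coe_eq ((hcoe _ _).2 hm) (hinj.ne (by linarith))
  have hle : ℓ x - 1 ≤ ℓ x + 1 := by linarith
  rcases hmono with hmono | hmono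
  · have h3 : η (ℓ x) < η (ℓ x + 1) := hmono (by linarith)
    have h4 : η (ℓ x - 1) < η (ℓ x) := hmono (by linarith)
    rw [abs_of_neg (by linarith)] at h1 h2
    exact intermediate_value_Icc hle hηc.continuousOn ⟨by linarith, by linarith⟩
  · have h3 : η (ℓ x + 1) < η (ℓ x) := hmono (by linarith)
    have h4 : η (ℓ x) < η (ℓ x - 1) := hmono (by linarith)
    rw [abs_of_pos (by linarith)] at h1 h2
    exact intermediate_value_Icc' hle hηc.continuousOn ⟨by linarith, by linarith⟩

end Comparison

end Slithering

/-! ### The foliation of a slithering on the universal covering -/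

theorem eq_of_coe_eq_of_abs_sub_lt_one {a b : ℝ} (h : (a : UnitAddCircle) = b)
    (hab : |b - a| < 1) : a = b := by
  by_contra hne
  exact absurd (Slithering.one_le_abs_sub_of_coe_eq h hne) (not_le.2 hab)

/-- A continuous real function on the circle is not locally injective. -/
theorem exists_not_injOn_of_unitAddCircle {g : UnitAddCircle → ℝ} (hg : Continuous g) :
    ∃ t, ∀ U ∈ 𝓝 t, ¬ InjOn g U := by
  obtain ⟨t, -, ht⟩ := isCompact_univ.exists_isMaxOn univ_nonempty hg.continuousOn
  refine ⟨t, fun U hU hinj => ?_⟩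
  obtain ⟨a, rfl⟩ := QuotientAddGroup.mk_surjective t
  have hcoe : Continuous ((↑) : ℝ → UnitAddCircle) := AddCircle.continuous_mk' 1
  obtain ⟨δ, hδ, hball⟩ := Metric.mem_nhds_iff.1 (hcoe.continuousAt hU)
  -- The bound `1 / 2` keeps any two reals within `η` of `a` less than one apart, so that equality
  -- on the circle is equality in `ℝ`.
  obtain ⟨η, hη, hηδ, hη1⟩ : ∃ η > 0, η < δ ∧ η < 1 / 2 :=
    ⟨min δ (1 / 2) / 2, by positivity, by linarith [min_le_left δ (1 / 2)],
      by linarith [min_le_right δ (1 / 2)]⟩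
  have hinj' : ∀ u v : ℝ, |u - a| ≤ η → |v - a| ≤ η → g u = g v → u = v := by
    intro u v hu hv huv
    have hmem : ∀ w : ℝ, |w - a| ≤ η → (w : UnitAddCircle) ∈ U := fun w hw =>
      hball (by rw [Metric.mem_ball, Real.dist_eq]; linarith)
    refine eq_of_coe_eq_of_abs_sub_lt_one (hinj (hmem u hu) (hmem v hv) huv) ?_
    rw [abs_le] at hu hv
    rw [abs_lt]
    constructor <;> linarith
  have hmax : ∀ u : ℝ, g u ≤ g a := fun u => ht (mem_univ (u : UnitAddCircle))
  have h1 : |a - η - a| ≤ η := by rw [abs_le]; constructor <;> linarith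
  have h2 : |a + η - a| ≤ η := by rw [abs_le]; constructor <;> linarith
  -- The larger of the two values at `a ± η` is at most the maximum `g a`, so it is attained again
  -- on the other side of `a`.
  rcases le_total (g ↑(a - η)) (g ↑(a + η)) with hle | hle
  · obtain ⟨c, hc, hcg⟩ := intermediate_value_Icc (by linarith : a - η ≤ a)
      (hg.comp hcoe).continuousOn ⟨hle, hmax (a + η)⟩
    have := hinj' c (a + η) (by rw [abs_le]; constructor <;> linarith [hc.1, hc.2]) h2 hcg
    linarith [hc.2]
  · obtain ⟨c, hc, hcg⟩ := intermediate_value_Icc' (by linarith : a ≤ a + η)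
      (hg.comp hcoe).continuousOn ⟨hle, hmax (a - η)⟩
    have := hinj' c (a - η) (by rw [abs_le]; constructor <;> linarith [hc.1, hc.2]) h1 hcg
    linarith [hc.1]

/-- A null-homotopic map lifts through a surjective covering. -/
theorem IsCoveringMap.exists_lift_of_nullhomotopic {A X M : Type*} [TopologicalSpace A]
    [TopologicalSpace X] [TopologicalSpace M] {q : X → M} (hq : IsCoveringMap q)
    (hsurj : Function.Surjective q) {γ : C(A, M)} (hγ : γ.Nullhomotopic) :
    ∃ Γ : C(A, X), q ∘ Γ = γ := by
  obtain ⟨m, ⟨H⟩⟩ := hγ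
  obtain ⟨x, rfl⟩ := hsurj m
  -- Run backwards, the null-homotopy starts at a constant map, which certainly lifts.
  have h0 : ∀ a, H.symm.toContinuousMap (0, a) = q (ContinuousMap.const A x a) := by
    intro a
    exact H.symm.apply_zero a
  let G := hq.liftHomotopy H.symm.toContinuousMap (ContinuousMap.const A x) h0
  refine ⟨⟨fun a => G (1, a), by fun_prop⟩, ?_⟩
  funext a
  exact (congrFun (hq.liftHomotopy_lifts _ _ h0) (1, a)).trans (H.symm.apply_one a)

namespace Slithering

variable {k : ℕ} {M M' X : Type*} [TopologicalSpace M] [TopologicalSpace M'] [TopologicalSpace X]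
  {S : Slithering k M M' UnitAddCircle} {q : X → M} {ℓ : X → ℝ}

/-- Pulling the chart condition back along `f` only compares `ℓ` mod `ℤ`. On a ball of radius `1 /
2` in height, congruence is equality. -/
theorem IsRealLift.exists_nhds_chart (h : S.IsRealLift q ℓ)
    {e : OpenPartialHomeomorph M (HalfSpace k × ℝ)} (he : e ∈ S.foliation.charts) {x : X}
    (hx : q x ∈ e.source) :
    ∃ U ∈ 𝓝 x, ∀ y ∈ U, ∀ z ∈ U, (e (q y)).2 = (e (q z)).2 ↔ ℓ y = ℓ z := by
  obtain ⟨hℓ, f, hf, rfl, hs⟩ := h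
  obtain ⟨V, hV, hVe⟩ := he (f x) hx
  refine ⟨f ⁻¹' V ∩ ℓ ⁻¹' Metric.ball (ℓ x) (1 / 2), Filter.inter_mem (hf.continuousAt hV)
    (hℓ.continuousAt (Metric.ball_mem_nhds _ (by norm_num))), ?_⟩
  rintro y ⟨hyV, hy⟩ z ⟨hzV, hz⟩
  rw [Function.comp_apply, Function.comp_apply, hVe _ hyV _ hzV, ← hs, ← hs]
  refine ⟨fun heq => eq_of_coe_eq_of_abs_sub_lt_one heq ?_, fun heq => by rw [heq]⟩
  rw [mem_preimage, Metric.mem_ball, Real.dist_eq, abs_lt] at hy hz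
  rw [abs_lt]
  constructor <;> linarith

theorem IsRealLift.isLeafwise_iff (h : S.IsRealLift q ℓ) (hq : IsLocalHomeomorph q) {x y : X}
    (γ : Path x y) : (S.foliation.lift hq).IsLeafwise γ ↔ ∀ t, ℓ (γ t) = ℓ x := by
  constructor
  · intro hγ
    have hloc : IsLocallyConstant (ℓ ∘ γ) := by
      rw [IsLocallyConstant.iff_eventually_eq]
      intro t
      obtain ⟨e', he', hte'⟩ := (S.foliation.lift hq).exists_chart (γ t)
      have h1 := hγ t e' he' hte'
      obtain ⟨φ, e, he, hφ, rfl⟩ := he'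
      rw [OpenPartialHomeomorph.trans_source] at hte'
      have hsrc : q (γ t) ∈ e.source := hφ ▸ hte'.2
      obtain ⟨U, hU, hUe⟩ := h.exists_nhds_chart he hsrc
      filter_upwards [h1, γ.continuous.continuousAt hU] with t' h2 h3
      refine (hUe _ h3 _ (mem_of_mem_nhds hU)).1 ?_
      simpa [hφ] using h2
    intro t
    simpa using hloc.apply_eq_of_isPreconnected isPreconnected_univ (mem_univ t) (mem_univ 0)
  · rintro hγ t _ ⟨φ, e, he, hφ, rfl⟩ ht
    rw [OpenPartialHomeomorph.trans_source] at ht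
    have hsrc : q (γ t) ∈ e.source := hφ ▸ ht.2
    obtain ⟨U, hU, hUe⟩ := h.exists_nhds_chart he hsrc
    filter_upwards [γ.continuous.continuousAt hU] with t' h3
    simpa [hφ] using (hUe _ h3 _ (mem_of_mem_nhds hU)).2 (by rw [hγ, hγ])

/-- On the lifted closed curve the transverse coordinate and `ℓ` have locally the same fibers, so
`ℓ` would be locally injective on a circle. -/
theorem not_nullhomotopic_of_isTransverse (hq : IsCoveringMap q) (hsurj : Function.Surjective q)
    (h : S.IsRealLift q ℓ) {γ : C(UnitAddCircle, M)} (hγ : S.foliation.IsTransverse γ) :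
    ¬ γ.Nullhomotopic := by
  intro hnull
  obtain ⟨Γ, hΓ⟩ := hq.exists_lift_of_nullhomotopic hsurj hnull
  have hΓ' : ∀ t, q (Γ t) = γ t := congrFun hΓ
  obtain ⟨t, ht⟩ := exists_not_injOn_of_unitAddCircle (h.1.comp Γ.continuous)
  obtain ⟨e, he, hte⟩ := S.foliation.exists_chart (γ t)
  obtain ⟨V, hV, hinj⟩ := hγ t e he hte
  rw [← hΓ'] at hte
  obtain ⟨U, hU, hUe⟩ := h.exists_nhds_chart he hte
  refine ht _ (Filter.inter_mem hV (Γ.continuous.continuousAt hU)) ?_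
  rintro a ⟨haV, haU⟩ b ⟨hbV, hbU⟩ hab
  refine hinj haV hbV ?_
  simpa only [hΓ'] using (hUe _ haU _ hbU).2 hab

variable [SimplyConnectedSpace X]

theorem IsRealLift.leaf_eq (h : S.IsRealLift q ℓ) (hq : IsCoveringMap q) (x : X) :
    (S.foliation.lift hq.isLocalHomeomorph).leaf x = ℓ ⁻¹' {ℓ x} := by
  ext y
  constructor
  · rintro ⟨γ, hγ⟩
    simpa using (h.isLeafwise_iff _ γ).1 hγ 1
  · intro hy
    obtain ⟨γ, hγ⟩ := (h.hasLocalTransport hq).exists_path_in_fiber h.1 (Eq.symm hy)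
    exact ⟨γ, (h.isLeafwise_iff _ γ).2 hγ⟩

theorem IsRealLift.leaves_eq (h : S.IsRealLift q ℓ) (hq : IsCoveringMap q) :
    (S.foliation.lift hq.isLocalHomeomorph).leaves = range (fun r : ℝ => ℓ ⁻¹' {r}) := by
  rw [Foliation.leaves, funext (h.leaf_eq hq)]
  exact (h.hasLocalTransport hq).surjective.range_comp (fun r : ℝ => ℓ ⁻¹' {r})

end Slithering

/-! ### The lifted path metric -/

section LiftedEDist

variable {M X : Type*} [MetricSpace M] [TopologicalSpace X] {q : X → M}

theorem liftedEDist_le {x y : X} (γ : Path x y) :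
    liftedEDist q x y ≤ eVariationOn (q ∘ γ) univ :=
  iInf_le _ γ

theorem liftedEDist_self (x : X) : liftedEDist q x x = 0 := by
  refine le_antisymm ((liftedEDist_le (Path.refl x)).trans_eq ?_) zero_le
  refine eVariationOn.constant_on ?_
  rintro _ ⟨t, -, rfl⟩ _ ⟨t', -, rfl⟩
  rfl

theorem liftedEDist_comm_le (x y : X) : liftedEDist q x y ≤ liftedEDist q y x := by
  refine le_iInf fun γ => (liftedEDist_le γ.symm).trans ?_
  exact eVariationOn.comp_le_of_antitoneOn (q ∘ γ) unitInterval.symm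
    (fun a _ b _ hab => unitInterval.symm_le_symm.2 hab) (fun _ _ => mem_univ _)

theorem liftedEDist_comm (x y : X) : liftedEDist q x y = liftedEDist q y x :=
  le_antisymm (liftedEDist_comm_le x y) (liftedEDist_comm_le y x)

theorem eVariationOn_path_trans_le {x y z : X} (γ : Path x y) (γ' : Path y z) :
    eVariationOn (q ∘ γ.trans γ') univ ≤ eVariationOn (q ∘ γ) univ + eVariationOn (q ∘ γ') univ := by
  let h : unitInterval := ⟨1 / 2, by norm_num, by norm_num⟩
  conv_lhs => rw [← Iic_union_Ici (a := h), eVariationOn.union _ isGreatest_Iic isLeast_Ici]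
  refine add_le_add ?_ ?_
  · have heq : EqOn (q ∘ γ.trans γ')
        ((q ∘ γ) ∘ fun t : unitInterval => projIcc (0 : ℝ) 1 zero_le_one (2 * t)) (Iic h) := by
      intro t ht
      have ht' : (t : ℝ) ≤ 1 / 2 := ht
      simp only [Function.comp_apply, Path.trans, Path.coe_mk_mk, ht', if_true]
      rfl
    rw [eVariationOn.congr heq]
    refine eVariationOn.comp_le_of_monotoneOn _ _ (fun a _ b _ hab => ?_) (fun _ _ => mem_univ _)
    exact monotone_projIcc _ (mul_le_mul_of_nonneg_left (Subtype.coe_le_coe.2 hab) zero_le_two)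
  · have heq : EqOn (q ∘ γ.trans γ')
        ((q ∘ γ') ∘ fun t : unitInterval => projIcc (0 : ℝ) 1 zero_le_one (2 * t - 1)) (Ici h) := by
      intro t ht
      have ht' : (1 / 2 : ℝ) ≤ t := ht
      -- At the midpoint `Path.trans` uses its first branch, where both formulas give `y`.
      rcases ht'.eq_or_lt with heq | hlt
      · have : t = h := Subtype.ext heq.symm
        subst this
        simp [Path.trans_apply, h, projIcc]
      · simp only [Function.comp_apply, Path.trans, Path.coe_mk_mk, not_le.2 hlt, if_false]
        rfl
    rw [eVariationOn.congr heq]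
    refine eVariationOn.comp_le_of_monotoneOn _ _ (fun a _ b _ hab => ?_) (fun _ _ => mem_univ _)
    refine monotone_projIcc _ (sub_le_sub_right ?_ _)
    exact mul_le_mul_of_nonneg_left (Subtype.coe_le_coe.2 hab) zero_le_two

theorem liftedEDist_triangle (x y z : X) :
    liftedEDist q x z ≤ liftedEDist q x y + liftedEDist q y z := by
  unfold liftedEDist
  refine ENNReal.le_iInf_add_iInf fun γ γ' => ?_
  exact (liftedEDist_le (γ.trans γ')).trans (eVariationOn_path_trans_le γ γ')

/-- The distance from the start of a path to any of its points is at most its length. -/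
theorem liftedEDist_le_of_path {x y : X} (γ : Path x y) (t : unitInterval) :
    liftedEDist q x (γ t) ≤ eVariationOn (q ∘ γ) univ := by
  let σ : Path x (γ t) :=
    { toFun := fun u => γ (min u t)
      continuous_toFun := by fun_prop
      source' := by simp
      target' := by rw [min_eq_right unitInterval.le_one'] }
  refine (liftedEDist_le σ).trans ?_
  exact eVariationOn.comp_le_of_monotoneOn (q ∘ γ) (fun u => min u t)
    (fun a _ b _ hab => min_le_min_right _ hab) (fun _ _ => mem_univ _)

theorem liftedEDist_map_le {g : X → X} (hg : Continuous g) (hqg : q ∘ g = q) (x y : X) :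
    liftedEDist q (g x) (g y) ≤ liftedEDist q x y := by
  refine le_iInf fun γ => (liftedEDist_le (γ.map hg)).trans_eq ?_
  rw [Path.map_coe, ← Function.comp_assoc, hqg]

/-- Short paths downstairs lift to a sheet over a ball. -/
theorem liftedEDist_lt_of_mem_source (hM : IsPathMetric M) {φ : OpenPartialHomeomorph X M}
    (hφ : ⇑φ = q) {x y : X} (hx : x ∈ φ.source) (hy : y ∈ φ.source) {δ : ℝ}
    (hball : Metric.ball (q x) δ ⊆ φ.target) (hxy : edist (q x) (q y) < ENNReal.ofReal δ) :
    liftedEDist q x y < ENNReal.ofReal δ := by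
  rw [hM, iInf_lt_iff] at hxy
  obtain ⟨σ, hσ⟩ := hxy
  have hmem : ∀ t, σ t ∈ φ.target := by
    intro t
    refine hball ?_
    rw [Metric.mem_ball', ← edist_lt_ofReal]
    refine lt_of_le_of_lt ?_ hσ
    have := eVariationOn.edist_le σ (mem_univ (0 : unitInterval)) (mem_univ t)
    rwa [σ.source] at this
  let γ : Path x y :=
    { toFun := fun t => φ.symm (σ t)
      continuous_toFun := φ.continuousOn_symm.comp_continuous σ.continuous hmem
      source' := by rw [σ.source, ← hφ, φ.left_inv hx]
      target' := by rw [σ.target, ← hφ, φ.left_inv hy] }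
  have hγ : q ∘ γ = σ := by
    funext t
    have := φ.right_inv (hmem t)
    rwa [hφ] at this
  refine (liftedEDist_le γ).trans_lt ?_
  rwa [hγ]

/-- A short path starting in a sheet over a ball ends in the same sheet. -/
theorem IsCoveringMap.mem_source_of_eVariationOn_lt (hq : IsCoveringMap q)
    {φ : OpenPartialHomeomorph X M} (hφ : ⇑φ = q) {γ : unitInterval → X} (hγ : Continuous γ)
    {a b : unitInterval} (hab : a ≤ b) (ha : γ a ∈ φ.source) {δ : ℝ}
    (hball : Metric.ball (q (γ a)) δ ⊆ φ.target)
    (hlt : eVariationOn (q ∘ γ) (Icc a b) < ENNReal.ofReal δ) : γ b ∈ φ.source := by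
  have hmem : MapsTo (q ∘ γ) (Icc a b) φ.target := by
    intro t ht
    refine hball ?_
    rw [Metric.mem_ball', ← edist_lt_ofReal]
    exact (eVariationOn.edist_le (q ∘ γ) (left_mem_Icc.2 hab) ht).trans_lt hlt
  have heq : EqOn γ (fun t => φ.symm (q (γ t))) (Icc a b) := by
    refine hq.eqOn_of_comp_eqOn isPreconnected_Icc hγ.continuousOn
      (φ.continuousOn_symm.comp (hq.continuous.comp hγ).continuousOn hmem) (fun t ht => ?_)
      (left_mem_Icc.2 hab) ?_
    · have := φ.right_inv (hmem ht)
      rw [hφ] at this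
      exact this.symm
    · rw [← hφ, φ.left_inv ha]
  rw [heq (right_mem_Icc.2 hab)]
  exact φ.map_target (hmem (right_mem_Icc.2 hab))

end LiftedEDist

/-! ### Comparison of a real lift with the lifted path metric -/

/-- `m` is the integer part of `|t - r|`: then `|z|` is `2 * m` if `t - r` is an integer and `2 * m
+ 1` otherwise. -/
theorem exists_nat_le_abs_sub_and_zSep_le (r t : ℝ) :
    ∃ m : ℕ, (m : ℝ) ≤ |t - r| ∧ |(zSep r t : ℝ)| - 1 ≤ 2 * m := by
  unfold zSep
  split_ifs with h
  · refine ⟨⌊t - r⌋.natAbs, ?_, ?_⟩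
    · rw [Nat.cast_natAbs, Int.cast_abs, h]
    · rw [Nat.cast_natAbs, Int.cast_abs]
      push_cast
      rw [abs_mul, abs_of_pos (two_pos : (0 : ℝ) < 2)]
      linarith
  · have h1 := Int.floor_le (t - r)
    have h2 := Int.lt_floor_add_one (t - r)
    rcases le_or_gt 0 ⌊t - r⌋ with h0 | h0
    · obtain ⟨j, hj⟩ := Int.eq_ofNat_of_zero_le h0
      rw [hj] at h1 h2 ⊢
      push_cast at h1 h2 ⊢
      have hj0 : (0 : ℝ) ≤ j := j.cast_nonneg
      refine ⟨j, h1.trans (le_abs_self _), ?_⟩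
      rw [abs_of_nonneg (by positivity)]
      linarith
    · obtain ⟨j, hj⟩ := Int.eq_ofNat_of_zero_le (show 0 ≤ -⌊t - r⌋ - 1 by omega)
      have hj' : ⌊t - r⌋ = -(j : ℤ) - 1 := by omega
      rw [hj'] at h1 h2 ⊢
      push_cast at h1 h2 ⊢
      have hj0 : (0 : ℝ) ≤ j := j.cast_nonneg
      refine ⟨j, ?_, ?_⟩
      · have := neg_le_abs (t - r)
        linarith
      · rw [abs_of_neg (by linarith)]
        linarith

theorem abs_sub_le_abs_zSep (r t : ℝ) : |t - r| ≤ |(zSep r t : ℝ)| := by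
  unfold zSep
  split_ifs with h
  · push_cast
    rw [h, abs_mul, abs_of_pos (two_pos : (0 : ℝ) < 2)]
    linarith [abs_nonneg (t - r)]
  · have h1 := lt_of_le_of_ne (Int.floor_le (t - r)) h
    have h2 := Int.lt_floor_add_one (t - r)
    rcases le_or_gt 0 ⌊t - r⌋ with h0 | h0
    · have h3 : (0 : ℝ) ≤ ⌊t - r⌋ := by exact_mod_cast h0
      push_cast
      rw [abs_of_nonneg (by linarith), abs_of_nonneg (by linarith)]
      linarith
    · have h3 : (⌊t - r⌋ : ℝ) ≤ -1 := by exact_mod_cast (show ⌊t - r⌋ ≤ -1 by omega)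
      push_cast
      rw [abs_of_nonpos (by linarith), abs_of_nonpos (by linarith)]
      linarith

namespace Slithering

variable {k : ℕ} {M M' X : Type*} [MetricSpace M] [TopologicalSpace M']
  [TopologicalSpace X] {S : Slithering k M M' UnitAddCircle} {q : X → M} {ℓ : X → ℝ}

/-! ### Lower bound: crossing one unit of height costs a definite length. -/

section LowerBound

variable [CompactSpace M] [SimplyConnectedSpace X] [LocallyPathConnectedSpace X]

/-- There are sheets of uniform size on which all real lifts vary by less than one. -/
theorem exists_uniform_sheets (hq : IsCoveringMap q) (hsurj : Function.Surjective q)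
    (h : S.IsRealLift q ℓ) :
    ∃ δ > 0, ∀ x, ∃ φ : OpenPartialHomeomorph X M, ⇑φ = q ∧ x ∈ φ.source ∧
      Metric.ball (q x) δ ⊆ φ.target ∧
      ∀ ℓ', S.IsRealLift q ℓ' → ∀ y ∈ φ.source, |ℓ' y - ℓ' x| < 1 := by
  have hloc : ∀ x, ∃ φ : OpenPartialHomeomorph X M, ⇑φ = q ∧ x ∈ φ.source ∧
      ∀ y ∈ φ.source, ∀ z ∈ φ.source, |ℓ z - ℓ y| < 1 := by
    intro x
    obtain ⟨φ, hx, hφ⟩ := hq.isLocalHomeomorph x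
    have hopen : IsOpen (ℓ ⁻¹' Metric.ball (ℓ x) (1 / 2)) := Metric.isOpen_ball.preimage h.1
    refine ⟨φ.restrOpen _ hopen, hφ.symm, ⟨hx, Metric.mem_ball_self (by norm_num)⟩, ?_⟩
    rintro y ⟨-, hy⟩ z ⟨-, hz⟩
    rw [mem_preimage, Metric.mem_ball, Real.dist_eq, abs_lt] at hy hz
    rw [abs_lt]
    constructor <;> linarith
  choose φ hφ hmem hosc using hloc
  -- `δ` is a Lebesgue number of the cover of `M` by images of sheets with small oscillation of `ℓ`.
  obtain ⟨δ, hδ, hleb⟩ := lebesgue_number_lemma_of_metric (isCompact_univ (X := M))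
    (c := fun x => (φ x).target) (fun x => (φ x).open_target) (fun m _ => by
      obtain ⟨x, rfl⟩ := hsurj m
      refine mem_iUnion.2 ⟨x, ?_⟩
      have := (φ x).map_source (hmem x)
      rwa [hφ] at this)
  refine ⟨δ, hδ, fun x => ?_⟩
  obtain ⟨i, hi⟩ := hleb (q x) (mem_univ _)
  have hqx : q x ∈ (φ i).target := hi (Metric.mem_ball_self hδ)
  have hx' : q ((φ i).symm (q x)) = q x := by
    have := (φ i).right_inv hqx
    rwa [hφ] at this
  -- The chosen sheet need not contain `x`, so its translate by `g.symm` is used. There `ℓ'` behaves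
  -- like the real lift `ℓ' ∘ g.symm` on the original sheet, which the oscillation of `ℓ` controls.
  obtain ⟨g, hg, hgx⟩ := hq.exists_deck hx'.symm
  have hg' : q ∘ g.symm = q := by
    rw [← hg, Function.comp_assoc, g.self_comp_symm, Function.comp_id, hg]
  have hsrc : g x ∈ (φ i).source := hgx ▸ (φ i).map_target hqx
  refine ⟨g.toOpenPartialHomeomorph.trans (φ i), ?_, ?_, ?_, ?_⟩
  · rw [OpenPartialHomeomorph.coe_trans, hφ]
    exact hg
  · rw [OpenPartialHomeomorph.trans_source]
    exact ⟨mem_univ _, hsrc⟩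
  · rw [OpenPartialHomeomorph.trans_target]
    exact fun m hm => ⟨hi hm, mem_univ _⟩
  · intro ℓ' h' y hy
    rw [OpenPartialHomeomorph.trans_source] at hy
    have := h.abs_sub_lt_one hq (h'.comp_deck g.symm hg') (hosc i (g x) hsrc (g y) hy.2)
    simpa using this

omit [CompactSpace M] [SimplyConnectedSpace X] [LocallyPathConnectedSpace X] in
/-- If `ℓ` changes by at least `m` along a path, then the path has length at least `m δ`. -/
theorem mul_le_eVariationOn (hq : IsCoveringMap q) (hℓ : Continuous ℓ) {δ : ℝ}
    (hδ : ∀ x, ∃ φ : OpenPartialHomeomorph X M, ⇑φ = q ∧ x ∈ φ.source ∧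
      Metric.ball (q x) δ ⊆ φ.target ∧ ∀ y ∈ φ.source, |ℓ y - ℓ x| < 1)
    {γ : unitInterval → X} (hγ : Continuous γ) {b : unitInterval} (m : ℕ) :
    ∀ a ≤ b, (m : ℝ) ≤ |ℓ (γ b) - ℓ (γ a)| →
      m * ENNReal.ofReal δ ≤ eVariationOn (q ∘ γ) (Icc a b) := by
  induction m with
  | zero => simp
  | succ m ih =>
    intro a hab hm
    push_cast at hm
    have hm0 : (0 : ℝ) ≤ m := m.cast_nonneg
    obtain ⟨w, hw, hw1, hw2⟩ : ∃ w ∈ uIcc (ℓ (γ a)) (ℓ (γ b)), 1 ≤ |w - ℓ (γ a)| ∧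
        (m : ℝ) ≤ |ℓ (γ b) - w| := by
      rcases le_total (ℓ (γ a)) (ℓ (γ b)) with hle | hle
      · rw [abs_of_nonneg (by linarith)] at hm
        refine ⟨ℓ (γ a) + 1, mem_uIcc.2 (Or.inl ⟨by linarith, by linarith⟩), by simp, ?_⟩
        rw [abs_of_nonneg (by linarith)]
        linarith
      · rw [abs_of_nonpos (by linarith)] at hm
        refine ⟨ℓ (γ a) - 1, mem_uIcc.2 (Or.inr ⟨by linarith, by linarith⟩), by simp, ?_⟩
        rw [abs_of_nonpos (by linarith)]
        linarith
    obtain ⟨c, hc, rfl⟩ := intermediate_value_uIcc (hℓ.comp hγ).continuousOn hw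
    rw [uIcc_of_le hab] at hc
    -- If this piece were shorter than `δ`, it would end in the sheet of `γ a`, where `ℓ` varies by
    -- less than one.
    have h1 : ENNReal.ofReal δ ≤ eVariationOn (q ∘ γ) (Icc a c) := by
      by_contra! hlt
      obtain ⟨φ, hφ, ha, hball, hosc⟩ := hδ (γ a)
      exact absurd (hosc _ (hq.mem_source_of_eVariationOn_lt hφ hγ hc.1 ha hball hlt))
        (not_lt.2 hw1)
    have h2 := ih c hc.2 hw2
    have h3 := eVariationOn.Icc_add_Icc (q ∘ γ) hc.1 hc.2 (mem_univ c)
    simp only [univ_inter] at h3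
    rw [← h3, Nat.cast_succ, add_mul, one_mul, add_comm]
    exact add_le_add h1 h2

theorem exists_lower_bound (hq : IsCoveringMap q) (hsurj : Function.Surjective q)
    (h : S.IsRealLift q ℓ) :
    ∃ c > (0 : ℝ), ∀ ℓ', S.IsRealLift q ℓ' → ∀ x y,
      ENNReal.ofReal (c * (|(zSep (ℓ' x) (ℓ' y) : ℝ)| - 1)) ≤ liftedEDist q x y := by
  obtain ⟨δ, hδ, H⟩ := exists_uniform_sheets hq hsurj h
  -- Half of `δ`, because `m` unit crossings must pay for `|z| - 1 ≤ 2 * m`.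
  refine ⟨δ / 2, by positivity, fun ℓ' h' x y => le_iInf fun γ => ?_⟩
  obtain ⟨m, hm, hz⟩ := exists_nat_le_abs_sub_and_zSep_le (ℓ' x) (ℓ' y)
  have hvar := mul_le_eVariationOn hq h'.1 (δ := δ) (fun z => by
    obtain ⟨φ, h1, h2, h3, h4⟩ := H z
    exact ⟨φ, h1, h2, h3, h4 ℓ' h'⟩) γ.continuous (b := 1) m 0 zero_le_one (by simpa using hm)
  calc ENNReal.ofReal (δ / 2 * (|(zSep (ℓ' x) (ℓ' y) : ℝ)| - 1))
      ≤ ENNReal.ofReal (m * δ) := by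
        refine ENNReal.ofReal_le_ofReal ?_
        calc δ / 2 * (|(zSep (ℓ' x) (ℓ' y) : ℝ)| - 1) ≤ δ / 2 * (2 * m) := by gcongr
          _ = m * δ := by ring
    _ = m * ENNReal.ofReal δ := by
        rw [ENNReal.ofReal_mul m.cast_nonneg, ENNReal.ofReal_natCast]
    _ ≤ _ := hvar.trans (eVariationOn.mono _ (subset_univ _))

end LowerBound

end Slithering

/-! ### Upper bound: every height within one unit is reached within a bounded distance. -/

namespace Slithering

variable {k : ℕ} {M M' X : Type*} [MetricSpace M] [TopologicalSpace M']
  [TopologicalSpace X] {S : Slithering k M M' UnitAddCircle} {q : X → M} {ℓ : X → ℝ}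

theorem _root_.IsPathMetric.eventually_liftedEDist_lt_top (hM : IsPathMetric M)
    (hq : IsLocalHomeomorph q) (x : X) : ∃ δ : ℝ, ∀ᶠ y in 𝓝 x,
      liftedEDist q x y < ENNReal.ofReal δ := by
  obtain ⟨φ, hx, hφ⟩ := hq x
  obtain ⟨δ, hδ, hball⟩ := Metric.mem_nhds_iff.1 (φ.open_target.mem_nhds (φ.map_source hx))
  rw [← hφ] at hball
  refine ⟨δ, ?_⟩
  filter_upwards [φ.open_source.mem_nhds hx,
    hq.continuous.continuousAt (Metric.ball_mem_nhds (q x) hδ)] with y hy hyx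
  refine liftedEDist_lt_of_mem_source hM hφ.symm hx hy hball ?_
  rw [edist_lt_ofReal]
  exact Metric.mem_ball'.1 hyx

/-- A given path may have infinite length. Finite distance holds locally, in a sheet over a ball,
and spreads by connectedness. -/
theorem _root_.IsPathMetric.liftedEDist_lt_top [PreconnectedSpace X] (hM : IsPathMetric M)
    (hq : IsLocalHomeomorph q) (x y : X) : liftedEDist q x y < ⊤ := by
  refine isPreconnected_univ.induction₂ (fun x y => liftedEDist q x y < ⊤) (fun x _ => ?_)
    (fun x y z _ _ _ hxy hyz => ?_) (fun x y _ _ hxy => ?_) (mem_univ x) (mem_univ y)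
  · obtain ⟨δ, hδ⟩ := hM.eventually_liftedEDist_lt_top hq x
    rw [nhdsWithin_univ]
    exact hδ.mono fun y hy => hy.trans ENNReal.ofReal_lt_top
  · exact (liftedEDist_triangle x y z).trans_lt (ENNReal.add_lt_top.2 ⟨hxy, hyz⟩)
  · rwa [liftedEDist_comm]

/-- All values between `ℓ x` and `ℓ y` are attained at bounded distance from `x`. -/
theorem _root_.IsPathMetric.exists_bound_of_mem_uIcc [PreconnectedSpace X] (hM : IsPathMetric M)
    (hq : IsLocalHomeomorph q) (hℓ : Continuous ℓ) (x y : X) :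
    ∃ D : ℝ, 0 ≤ D ∧ ∀ a ∈ uIcc (ℓ x) (ℓ y), ∃ z, ℓ z = a ∧
      liftedEDist q x z ≤ ENNReal.ofReal D := by
  obtain ⟨γ, hγ⟩ := iInf_lt_iff.1 (hM.liftedEDist_lt_top hq x y)
  refine ⟨(eVariationOn (q ∘ γ) univ).toReal, ENNReal.toReal_nonneg, fun a ha => ?_⟩
  have ha' : a ∈ uIcc ((ℓ ∘ γ) 0) ((ℓ ∘ γ) 1) := by simpa using ha
  obtain ⟨t, -, ht⟩ := intermediate_value_uIcc (hℓ.comp γ.continuous).continuousOn ha'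
  refine ⟨γ t, ht, ?_⟩
  rw [ENNReal.ofReal_toReal hγ.ne]
  exact liftedEDist_le_of_path γ t

variable [SimplyConnectedSpace X]

theorem IsRealLift.exists_local_upper_bound (hM : IsPathMetric M) (hq : IsCoveringMap q)
    (h : S.IsRealLift q ℓ) (x : X) :
    ∃ C : ℝ, ∀ᶠ y in 𝓝 x, ∀ a, |a - ℓ y| ≤ 1 →
      ∃ z, ℓ z = a ∧ liftedEDist q y z ≤ ENNReal.ofReal C := by
  have hs := (h.hasLocalTransport hq).surjective
  -- Heights `ℓ x ± 2` suffice: `y` will be within one of `x` in height, and `a` within one of `y`.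
  obtain ⟨xp, hxp⟩ := hs (ℓ x + 2)
  obtain ⟨xm, hxm⟩ := hs (ℓ x - 2)
  obtain ⟨D, hD, hDp⟩ := hM.exists_bound_of_mem_uIcc hq.isLocalHomeomorph h.1 x xp
  obtain ⟨E, hE, hEm⟩ := hM.exists_bound_of_mem_uIcc hq.isLocalHomeomorph h.1 x xm
  obtain ⟨δ, hδ⟩ := hM.eventually_liftedEDist_lt_top hq.isLocalHomeomorph x
  refine ⟨max δ 0 + max D E, ?_⟩
  filter_upwards [hδ, h.1.continuousAt (Metric.ball_mem_nhds (ℓ x) one_pos)] with y hy hyx a ha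
  rw [mem_preimage, Metric.mem_ball, Real.dist_eq, abs_lt] at hyx
  rw [abs_le] at ha
  obtain ⟨z, hz, hxz⟩ : ∃ z, ℓ z = a ∧ liftedEDist q x z ≤ ENNReal.ofReal (max D E) := by
    rcases le_total (ℓ x) a with hle | hle
    · obtain ⟨z, hz, hxz⟩ := hDp a (mem_uIcc.2 (Or.inl ⟨hle, by linarith⟩))
      exact ⟨z, hz, hxz.trans (ENNReal.ofReal_le_ofReal (le_max_left _ _))⟩
    · obtain ⟨z, hz, hxz⟩ := hEm a (mem_uIcc.2 (Or.inr ⟨by linarith, hle⟩))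
      exact ⟨z, hz, hxz.trans (ENNReal.ofReal_le_ofReal (le_max_right _ _))⟩
  refine ⟨z, hz, (liftedEDist_triangle y x z).trans ?_⟩
  rw [ENNReal.ofReal_add (le_max_right _ _) (le_max_of_le_left hD)]
  refine add_le_add ?_ hxz
  rw [liftedEDist_comm]
  exact hy.le.trans (ENNReal.ofReal_le_ofReal (le_max_left _ _))

variable [CompactSpace M] [LocallyPathConnectedSpace X]

/-- Bounds over subsets of `M` pass to finite unions, so by compactness a bound near each point is
enough. -/
theorem IsRealLift.exists_unit_upper_bound (hM : IsPathMetric M) (hq : IsCoveringMap q)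
    (hsurj : Function.Surjective q) (h : S.IsRealLift q ℓ) :
    ∃ C : ℝ, ∀ x, ∀ ℓ', S.IsRealLift q ℓ' → ∀ t, |t - ℓ' x| ≤ 1 →
      ∃ y, ℓ' y = t ∧ liftedEDist q x y ≤ ENNReal.ofReal C := by
  suffices H : ∃ C : ℝ, ∀ x, q x ∈ (univ : Set M) → ∀ ℓ', S.IsRealLift q ℓ' →
      ∀ t, |t - ℓ' x| ≤ 1 → ∃ y, ℓ' y = t ∧ liftedEDist q x y ≤ ENNReal.ofReal C by
    obtain ⟨C, hC⟩ := H
    exact ⟨C, fun x => hC x (mem_univ _)⟩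
  refine isCompact_univ.induction_on (p := fun s : Set M => ∃ C : ℝ, ∀ x, q x ∈ s → ∀ ℓ',
    S.IsRealLift q ℓ' → ∀ t, |t - ℓ' x| ≤ 1 → ∃ y, ℓ' y = t ∧
      liftedEDist q x y ≤ ENNReal.ofReal C) ?_ ?_ ?_ ?_
  · exact ⟨0, fun x hx => hx.elim⟩
  · rintro s s' hss' ⟨C, hC⟩
    exact ⟨C, fun x hx => hC x (hss' hx)⟩
  · rintro s s' ⟨C, hC⟩ ⟨C', hC'⟩
    refine ⟨max C C', fun x hx ℓ' h' t ht => ?_⟩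
    rcases hx with hx | hx
    · obtain ⟨y, hy, hxy⟩ := hC x hx ℓ' h' t ht
      exact ⟨y, hy, hxy.trans (ENNReal.ofReal_le_ofReal (le_max_left _ _))⟩
    · obtain ⟨y, hy, hxy⟩ := hC' x hx ℓ' h' t ht
      exact ⟨y, hy, hxy.trans (ENNReal.ofReal_le_ofReal (le_max_right _ _))⟩
  · intro m _
    obtain ⟨x₀, rfl⟩ := hsurj m
    obtain ⟨C, hC⟩ := h.exists_local_upper_bound hM hq x₀
    refine ⟨_, mem_nhdsWithin_of_mem_nhds (hq.isOpenMap.image_mem_nhds hC), C, ?_⟩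
    rintro x ⟨y, hy, hyx⟩ ℓ' h' t ht
    -- Over `q y` every point is `g y` for a deck transformation `g`. The height `t` of `ℓ' ∘ g` is
    -- a height `a` of `ℓ` within one of `ℓ y`, which the local bound at `y` reaches.
    obtain ⟨g, hg, rfl⟩ := hq.exists_deck hyx
    obtain ⟨a, ha, hat⟩ := h.exists_value hq (h'.comp_deck g hg) y ht
    obtain ⟨z, hz, hyz⟩ := hy a ha
    exact ⟨g z, hat z hz, (liftedEDist_map_le g.continuous hg y z).trans hyz⟩

omit [SimplyConnectedSpace X] [CompactSpace M] [LocallyPathConnectedSpace X] in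
theorem exists_le_mul_of_unit_bound {C : ℝ}
    (hC : ∀ x t, |t - ℓ x| ≤ 1 → ∃ y, ℓ y = t ∧ liftedEDist q x y ≤ ENNReal.ofReal C)
    (m : ℕ) : ∀ x t, |t - ℓ x| ≤ m →
      ∃ y, ℓ y = t ∧ liftedEDist q x y ≤ m * ENNReal.ofReal C := by
  induction m with
  | zero =>
    intro x t ht
    have : t = ℓ x := by simpa [sub_eq_zero] using ht
    exact ⟨x, this.symm, by simp [liftedEDist_self]⟩
  | succ m ih =>
    intro x t ht
    push_cast at ht
    have hm0 : (0 : ℝ) ≤ m := m.cast_nonneg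
    obtain ⟨w, hw1, hw2⟩ : ∃ w, |w - ℓ x| ≤ m ∧ |t - w| ≤ 1 := by
      have hm1 : (0 : ℝ) < m + 1 := by positivity
      -- `w` divides the segment from `ℓ x` to `t` in the ratio `m : 1`, leaving one unit step.
      refine ⟨ℓ x + (t - ℓ x) * (m / (m + 1)), ?_, ?_⟩
      · rw [add_sub_cancel_left, abs_mul, abs_of_nonneg (by positivity : (0 : ℝ) ≤ m / (m + 1))]
        calc |t - ℓ x| * (m / (m + 1)) ≤ (m + 1) * (m / (m + 1)) := by gcongr
          _ = m := by field_simp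
      · have : t - (ℓ x + (t - ℓ x) * (m / (m + 1))) = (t - ℓ x) * (1 / (m + 1)) := by
          field_simp
          ring
        rw [this, abs_mul, abs_of_pos (by positivity : (0 : ℝ) < 1 / (m + 1))]
        calc |t - ℓ x| * (1 / (m + 1)) ≤ (m + 1) * (1 / (m + 1)) := by gcongr
          _ = 1 := by field_simp
    obtain ⟨y, rfl, hxy⟩ := ih x w hw1
    obtain ⟨z, hz, hyz⟩ := hC y t hw2
    refine ⟨z, hz, (liftedEDist_triangle x y z).trans ?_⟩
    rw [Nat.cast_succ, add_mul, one_mul]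
    exact add_le_add hxy hyz

theorem IsRealLift.exists_upper_bound (hM : IsPathMetric M) (hq : IsCoveringMap q)
    (hsurj : Function.Surjective q) (h : S.IsRealLift q ℓ) :
    ∃ C > (0 : ℝ), ∀ ℓ', S.IsRealLift q ℓ' → ∀ x t, ∃ y, ℓ' y = t ∧
      liftedEDist q x y ≤ ENNReal.ofReal (C * |(zSep (ℓ' x) t : ℝ)|) := by
  obtain ⟨C, hC⟩ := h.exists_unit_upper_bound hM hq hsurj
  refine ⟨max C 1, by positivity, fun ℓ' h' x t => ?_⟩
  have hcast : ((zSep (ℓ' x) t).natAbs : ℝ) = |(zSep (ℓ' x) t : ℝ)| := by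
    rw [Nat.cast_natAbs, Int.cast_abs]
  -- Since `|t - r| ≤ |z|`, taking `|z|` unit steps is enough.
  obtain ⟨y, hy, hxy⟩ := exists_le_mul_of_unit_bound (fun x => hC x ℓ' h')
    (zSep (ℓ' x) t).natAbs x t (by rw [hcast]; exact abs_sub_le_abs_zSep _ _)
  refine ⟨y, hy, hxy.trans ?_⟩
  rw [mul_comm (max C 1), ← hcast, ENNReal.ofReal_mul (Nat.cast_nonneg _), ENNReal.ofReal_natCast]
  gcongr
  exact le_max_left _ _

end Slithering

/-! ### Assembly of the theorem. -/

theorem mainTheorem4 {n : ℕ} {M M' X : Type*}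
    [MetricSpace M] [CompactSpace M] [ConnectedSpace M] [ChartedSpace (HalfSpace (n + 1)) M]
    (hM : IsPathMetric M)
    [TopologicalSpace M'] (S : Slithering n M M' UnitAddCircle)
    [TopologicalSpace X] [SimplyConnectedSpace X] {q : X → M} (hq : IsCoveringMap q) :
    S.foliation.IsUniform hq ∧
    (∃ ℓ, S.IsRealLift q ℓ) ∧
    ∃ C > (0 : ℝ), ∃ c > (0 : ℝ), ∀ ℓ, S.IsRealLift q ℓ →
      (S.foliation.lift hq.isLocalHomeomorph).leaves = Set.range (fun r : ℝ => ℓ ⁻¹' {r}) ∧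
      ∀ r t : ℝ,
        (∀ x ∈ ℓ ⁻¹' {r}, ∃ y ∈ ℓ ⁻¹' {t},
          liftedEDist q x y ≤ ENNReal.ofReal (C * |(zSep r t : ℝ)|)) ∧
        (∀ x ∈ ℓ ⁻¹' {r}, ∀ y ∈ ℓ ⁻¹' {t},
          ENNReal.ofReal (c * (|(zSep r t : ℝ)| - 1)) ≤ liftedEDist q x y) := by
  have : LocallyPathConnectedSpace M :=
    ChartedSpace.locallyPathConnectedSpace (HalfSpace (n + 1)) M
  have : LocallyPathConnectedSpace X := hq.isLocalHomeomorph.locallyPathConnectedSpace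
  have hsurj := hq.surjective_of_connected
  -- One reference lift produces `C` and `c`, and both then serve every real lift.
  obtain ⟨ℓ, h⟩ := S.exists_isRealLift hq.continuous
  obtain ⟨C, hC, hupper⟩ := h.exists_upper_bound hM hq hsurj
  obtain ⟨c, hc, hlower⟩ := Slithering.exists_lower_bound hq hsurj h
  refine ⟨⟨fun γ hγ => Slithering.not_nullhomotopic_of_isTransverse hq hsurj h hγ, ?_⟩, ⟨ℓ, h⟩,
    C, hC, c, hc, fun ℓ' h' => ⟨h'.leaves_eq hq, fun r t => ⟨?_, ?_⟩⟩⟩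
  · rw [h.leaves_eq hq]
    rintro _ ⟨r, rfl⟩ _ ⟨t, rfl⟩
    refine ⟨max (C * |(zSep r t : ℝ)|) (C * |(zSep t r : ℝ)|), ?_, ?_⟩
    · rintro x rfl
      obtain ⟨y, hy, hxy⟩ := hupper ℓ h x t
      exact ⟨y, hy, hxy.trans (ENNReal.ofReal_le_ofReal (le_max_left _ _))⟩
    · rintro x rfl
      obtain ⟨y, hy, hxy⟩ := hupper ℓ h x r
      exact ⟨y, hy, hxy.trans (ENNReal.ofReal_le_ofReal (le_max_right _ _))⟩
  · rintro x rfl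
    exact hupper ℓ' h' x t
  · rintro x rfl y rfl
    exact hlower ℓ' h' x y
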